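/- All Banach spaces are real. An a.d.-family is an uncountable family $\mathcal A$ of infinite subsets of $\mathbb N$ such that $A\cap B$ is finite for distinct $A,B\in\mathcal A$. It is a Luzin family if it has a one-to-one enumeration $\mathcal A=\{A_\xi:\xi<\omega_1\}$ such that for every $\eta<\omega_1$ the function $\xi\mapsto\max(A_\xi\cap A_\eta)$ on $\{\xi:\xi<\eta\}$ is finite-to-one (with $\max\emptyset=0$). A pairing of $\mathcal A$ is a map $\phi=(\phi_1,\phi_{-1}):\omega_1\to\mathcal A\times\mathcal A$ with $\phi_1(\alpha)\ne\phi_{-1}(\alpha)$ for all $\alpha$ and $\{\phi_1(\alpha),\phi_{-1}(\alpha)\}\cap\{\phi_1(\beta),\phi_{-1}(\beta)\}=\emptyset$ for $\alpha\neq\beta$. Let $\mathcal X_{\mathcal A}$ be the closed linear span in $(\ell_\infty,\|\cdot\|_\infty)$ of $c_0\cup\{1_A:A\in\mathcal A\}$ and $\mathcal X_{\mathcal A,\phi}$ the closed linear span of $c_0\cup\{1_{\phi_1(\alpha)}-1_{\phi_{-1}(\alpha)}:\alpha<\omega_1\}$. A subset of a normed space is $r$-separated if any two distinct points of it are at distance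 at least $r$. **Theorem.** (In ZFC.) There are a Luzin family $\mathcal A$ and a pairing $\phi$ of $\mathcal A$ such that the Banach space $\mathcal X=\mathcal X_{\mathcal A,\phi}\subseteq\mathcal X_{\mathcal A}$ with the norm $\|\cdot\|_\infty$ is nonseparable and, together with its closed separable subspace $\mathcal Y=c_0$, has the following properties: 1. For every $\delta>0$ there is $\varepsilon>0$ such that whenever $\mathcal Z$ is a subset of the unit sphere of $\mathcal X$ whose elements have pairwise distinct classes $[z]_{\mathcal Y}$ and $\{[z]_{\mathcal Y}:z\in\mathcal Z\}$ is a $(1-\varepsilon)$-separated subset of $\mathcal X/\mathcal Y$, then $\mathcal Z$ is the union of countably many $(2-\delta)$-separated sets. 2. For every $\varepsilon>0$, the closed unit ball of $\mathcal X/\mathcal Y$ (in particular its unit sphere) contains no uncountable $(1+\varepsilon)$-separated set. -/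

import Mathlib

open scoped ENNReal Ordinal Topology

noncomputable section

namespace ADSpace

/-- An a.d.-family: an uncountable family of infinite, pairwise almost disjoint subsets of `ℕ`. -/
def IsADFamily (𝒜 : Set (Set ℕ)) : Prop :=
  ¬ 𝒜.Countable ∧ (∀ A ∈ 𝒜, A.Infinite) ∧ 𝒜.Pairwise fun A B => (A ∩ B).Finite

/-- The set of ordinals below `ω₁`, as a type. -/
abbrev Omega1 : Type 1 := Set.Iio (ω_ 1 : Ordinal.{0})

/-- A Luzin family: an a.d.-family with a one-to-one enumeration `(A ξ : ξ < ω₁)` such that for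
each `η` the function `ξ ↦ max (A ξ ∩ A η)` on `η` is finite-to-one. The intersections are finite,
so `sSup` is the maximum; the maximum of the empty set is read as `0`. -/
def IsLuzinFamily (𝒜 : Set (Set ℕ)) : Prop :=
  IsADFamily 𝒜 ∧ ∃ A : Omega1 → Set ℕ, Function.Injective A ∧ Set.range A = 𝒜 ∧
    ∀ η : Omega1, ∀ n : ℕ, {ξ : Omega1 | ξ < η ∧ sSup (A ξ ∩ A η) = n}.Finite

/-- A pairing `φ = (φ₁, φ₋₁)` of `𝒜`: for each index two different members of `𝒜`, the pairs
for different indices being disjoint. -/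
def IsPairing {ι : Type*} (𝒜 : Set (Set ℕ)) (φ : ι → Set ℕ × Set ℕ) : Prop :=
  (∀ α, (φ α).1 ∈ 𝒜 ∧ (φ α).2 ∈ 𝒜 ∧ (φ α).1 ≠ (φ α).2) ∧
  ∀ α β, α ≠ β → Disjoint ({(φ α).1, (φ α).2} : Set (Set ℕ)) {(φ β).1, (φ β).2}

/-- The real Banach space `ℓ∞` of bounded sequences with the supremum norm. -/
abbrev Linfty : Type := lp (fun _ : ℕ => ℝ) ∞

/-- The characteristic function of `A ⊆ ℕ` as an element of `ℓ∞`. -/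
def charFn (A : Set ℕ) : Linfty :=
  ⟨A.indicator fun _ => (1 : ℝ), memℓp_infty ⟨1, by
    rintro _ ⟨n, rfl⟩
    by_cases h : n ∈ A <;> simp [h]⟩⟩

/-- The subspace `c₀` of `ℓ∞` of sequences converging to `0`. -/
def cZero : Submodule ℝ Linfty where
  carrier := {f | Filter.Tendsto (fun n : ℕ => f n) Filter.atTop (𝓝 0)}
  zero_mem' := by simp
  add_mem' := by
    intro f g hf hg
    simpa using Filter.Tendsto.add hf hg
  smul_mem' := by
    intro c f hf
    simpa using Filter.Tendsto.const_mul c hf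

/-- `𝒳_𝒜`: the closed linear span in `ℓ∞` of `c₀ ∪ {1_A : A ∈ 𝒜}`. -/
def spaceX (𝒜 : Set (Set ℕ)) : Submodule ℝ Linfty :=
  (Submodule.span ℝ ((cZero : Set Linfty) ∪ charFn '' 𝒜)).topologicalClosure

/-- `𝒳_{𝒜,φ}`: the closed linear span in `ℓ∞` of `c₀ ∪ {1_{φ₁(α)} - 1_{φ₋₁(α)} : α}`. -/
def spaceXPairing {ι : Type*} (φ : ι → Set ℕ × Set ℕ) : Submodule ℝ Linfty :=
  (Submodule.span ℝ ((cZero : Set Linfty) ∪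
    Set.range fun α => charFn (φ α).1 - charFn (φ α).2)).topologicalClosure

/-- `S` is `r`-separated: distinct points of `S` are at distance at least `r`. -/
def IsSeparatedBy {E : Type*} [SeminormedAddCommGroup E] (r : ℝ) (S : Set E) : Prop :=
  S.Pairwise fun x y => r ≤ ‖x - y‖

end ADSpace

end

namespace ADSpace

/-! Modulo `c₀`, an element of `𝒳` is close to a finite combination of the generators `1_{φ₁(α)} -
1_{φ₋₁(α)}`. By almost disjointness, the norm of its class is, up to the approximation error, the
largest absolute value of a coefficient.

Take `φ(α) = (A_{2α}, A_{2α+1})` for an enumerated Luzin family. For fixed `k` and `β`, only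
finitely many `α < β` have `A_{2α} ∩ A_{2β+1}` without a point past `k`. Hence the indices can be
coloured by `ℕ` so that two pairs of one colour always cross past `k`: some `p ≥ k` lies in the
first set of one and the second set of the other (`exists_luzinPair_coloring`).

Round the coefficients to multiples of a small mesh and let `k` be a point past which the
approximation holds and the sets involved are disjoint. The type of an element is `k` together with
its rounded coefficients, indexed by colours instead of ordinals; there are countably many types. If
two elements have the same type, their coefficients agree at common indices. A coefficient `c` at an
index of only one of them recurs in the other at a different index of the same colour, and at a
crossing point the values are near `c` and `-c`.

So, up to small errors, elements of one type satisfy `‖z - z'‖ ≥ 2 ‖[z] - [z']‖`, which gives the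
first property, and `‖[z] - [z']‖ ≤ max ‖[z]‖ ‖[z']‖`, which gives the second. -/

/-! ### Construction of a Luzin family -/

/-- A sequence of infinite, pairwise almost disjoint sets can be extended by a set that meets the
`k`-th one in a finite set with an element above `k`. -/
lemma exists_almost_disjoint_extension {ι : Type*} (e : ι ≃ ℕ) (D : ι → Set ℕ)
    (hinf : ∀ i, (D i).Infinite) (hD : Pairwise fun i j => (D i ∩ D j).Finite) :
    ∃ E : Set ℕ, E.Infinite ∧ (∀ i, (E ∩ D i).Finite) ∧
      ∀ n, {i | sSup (E ∩ D i) = n}.Finite := by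
  have hx : ∀ i, ∃ x ∈ D i, e i ≤ x ∧ ∀ j, e j < e i → x ∉ D j := by
    intro i
    -- Only finitely many points of `D i` lie below `e i` or in an earlier `D j`, so `x i` can avoid
    -- them all.
    have hfin : ((⋃ j ∈ {j | e j < e i}, D i ∩ D j) ∪ {x | x < e i}).Finite := by
      refine Set.Finite.union ?_ (Set.finite_lt_nat _)
      refine Set.Finite.biUnion ((Set.finite_lt_nat (e i)).preimage e.injective.injOn) ?_
      intro j hj
      exact hD (fun h => by subst h; exact lt_irrefl (e i) hj)
    obtain ⟨x, hxD, hx⟩ := ((hinf i).sdiff hfin).nonempty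
    refine ⟨x, hxD, ?_, ?_⟩
    · by_contra h
      exact hx (Or.inr (not_le.mp h))
    · intro j hj hxj
      exact hx (Or.inl (Set.mem_biUnion (show j ∈ {j | e j < e i} from hj) ⟨hxD, hxj⟩))
  choose x hxD hxe hxn using hx
  have hfin : ∀ i, (Set.range x ∩ D i).Finite := by
    intro i
    refine (((Set.finite_le_nat (e i)).preimage e.injective.injOn).image x).subset ?_
    rintro _ ⟨⟨j, rfl⟩, hj⟩
    refine ⟨j, ?_, rfl⟩
    by_contra h
    exact hxn j i (not_le.mp h) hj
  refine ⟨Set.range x, ?_, hfin, ?_⟩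
  · refine Set.infinite_of_forall_exists_gt fun n => ⟨x (e.symm (n + 1)), ⟨_, rfl⟩, ?_⟩
    have := hxe (e.symm (n + 1))
    simp at this
    omega
  · intro n
    refine ((Set.finite_le_nat n).preimage e.injective.injOn).subset ?_
    intro i hi
    have := le_csSup (hfin i).bddAbove (show x i ∈ _ from ⟨⟨i, rfl⟩, hxD i⟩)
    have h2 := hxe i
    simp only [Set.mem_ofPred_eq] at hi
    simp only [Set.mem_preimage, Set.mem_ofPred_eq]
    omega

lemma countable_Iio_omega1 (η : Omega1) : (Set.Iio η).Countable := by
  rw [← Set.countable_coe_iff]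
  have h : (Set.Iio η.1).Countable := by
    rw [← Cardinal.le_aleph0_iff_set_countable, Cardinal.mk_Iio_ordinal,
      ← Cardinal.lift_aleph0.{1, 0}, Cardinal.lift_le, ← Order.lt_succ_iff, Cardinal.succ_aleph0]
    have := (Ordinal.isInitial_omega 1).card_lt_card.2 η.2
    rwa [Ordinal.card_omega] at this
  have := h.to_subtype
  exact Function.Injective.countable
    (f := fun ξ : Set.Iio η => (⟨ξ.1.1, ξ.2⟩ : Set.Iio η.1)) (by
      intro a b hab
      exact Subtype.ext (Subtype.ext (Subtype.mk.inj hab)))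

lemma uncountable_omega1 : Uncountable Omega1 := by
  rw [← not_countable_iff]
  intro h
  have h2 : (Set.Iio (ω_ 1 : Ordinal.{0})).Countable := h
  rw [← Cardinal.le_aleph0_iff_set_countable, Cardinal.mk_Iio_ordinal,
      ← Cardinal.lift_aleph0.{1, 0}, Cardinal.lift_le, Ordinal.card_omega] at h2
  exact absurd h2 (not_le.mpr Cardinal.aleph0_lt_aleph_one)

/-- The sets in a fixed partition of `ℕ` into infinitely many infinite sets. -/
def column (n : ℕ) : Set ℕ := {m | (Nat.unpair m).1 = n}

lemma column_infinite (n : ℕ) : (column n).Infinite :=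
  Set.infinite_of_injective_forall_mem (f := fun k => Nat.pair n k)
    (fun a b h => (Nat.pair_eq_pair.mp h).2) (fun k => by simp [column])

/-- `E` extends the almost disjoint family consisting of the columns and the sets `F ξ`, `ξ < η`,
in the way required of the `η`-th member of a Luzin family. -/
def IsLuzinExtension (η : Omega1) (F : ∀ ξ, ξ < η → Set ℕ) (E : Set ℕ) : Prop :=
  E.Infinite ∧ (∀ n, (E ∩ column n).Finite) ∧ (∀ ξ h, (E ∩ F ξ h).Finite) ∧
    ∀ n : ℕ, {ξ | ∃ h : ξ < η, sSup (E ∩ F ξ h) = n}.Finite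

open Classical in
/-- An enumerated Luzin family, obtained by recursion. -/
def luzin : Omega1 → Set ℕ :=
  wellFounded_lt.fix fun η F =>
    if h : ∃ E, IsLuzinExtension η F E then h.choose else ∅

open Classical in
lemma luzin_spec (η : Omega1) : IsLuzinExtension η (fun ξ _ => luzin ξ) (luzin η) := by
  induction η using WellFoundedLT.induction with
  | ind η ih =>
    have hex : ∃ E, IsLuzinExtension η (fun ξ _ => luzin ξ) E := by
      have : Countable (Set.Iio η) := (countable_Iio_omega1 η).to_subtype
      -- The columns keep the family countably infinite even when `η` is finite.
      obtain ⟨e⟩ : Nonempty (ℕ ⊕ Set.Iio η ≃ ℕ) := nonempty_equiv_of_countable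
      obtain ⟨E, hE, hfin, hsup⟩ := exists_almost_disjoint_extension e
        (Sum.elim column fun ξ => luzin ξ.1) (by
          rintro (n | ⟨ξ, hξ⟩)
          · exact column_infinite n
          · exact (ih ξ hξ).1) (by
          rintro (m | ⟨ξ, hξ⟩) (n | ⟨ζ, hζ⟩) hne
          · have : (column m ∩ column n) = ∅ := by
              ext x
              simp only [column, Set.mem_inter_iff, Set.mem_ofPred_eq, Set.mem_empty_iff_false,
                iff_false, not_and]
              rintro rfl h
              exact hne (by rw [h])
            simp [this]
          · simpa [Set.inter_comm] using (ih ζ hζ).2.1 m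
          · simpa using (ih ξ hξ).2.1 n
          · rcases lt_trichotomy ξ ζ with h | h | h
            · simpa [Set.inter_comm] using (ih ζ hζ).2.2.1 ξ h
            · subst h; exact absurd rfl hne
            · simpa using (ih ξ hξ).2.2.1 ζ h)
      refine ⟨E, hE, fun n => hfin (Sum.inl n), fun ξ h => hfin (Sum.inr ⟨ξ, h⟩), fun n => ?_⟩
      refine (((hsup n).preimage Sum.inr_injective.injOn).image Subtype.val).subset ?_
      rintro ξ ⟨h, hn⟩
      exact ⟨⟨ξ, h⟩, hn, rfl⟩
    have hfix : luzin η = if h : ∃ E, IsLuzinExtension η (fun ξ _ => luzin ξ) E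
        then h.choose else ∅ := by
      conv_lhs => rw [luzin, WellFounded.fix_eq]
      rfl
    rw [hfix, dif_pos hex]
    exact hex.choose_spec

lemma luzin_infinite (η : Omega1) : (luzin η).Infinite := (luzin_spec η).1

lemma luzin_inter_finite {ξ η : Omega1} (h : ξ ≠ η) : (luzin ξ ∩ luzin η).Finite := by
  rcases lt_or_gt_of_ne h with h | h
  · rw [Set.inter_comm]; exact (luzin_spec η).2.2.1 ξ h
  · exact (luzin_spec ξ).2.2.1 η h

lemma luzin_injective : Function.Injective luzin := by
  intro ξ η h
  by_contra hne
  have := luzin_inter_finite hne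
  rw [h, Set.inter_self] at this
  exact luzin_infinite η this

lemma finite_sSup_luzin_inter (η : Omega1) (n : ℕ) :
    {ξ : Omega1 | ξ < η ∧ sSup (luzin ξ ∩ luzin η) = n}.Finite := by
  refine ((luzin_spec η).2.2.2 n).subset ?_
  rintro ξ ⟨h, hn⟩
  exact ⟨h, by rwa [Set.inter_comm]⟩

lemma isLuzinFamily_range_luzin : IsLuzinFamily (Set.range luzin) := by
  refine ⟨⟨?_, ?_, ?_⟩, luzin, luzin_injective, rfl, finite_sSup_luzin_inter⟩
  · intro h
    have := uncountable_omega1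
    exact not_countable (α := Omega1)
      (Set.countable_univ_iff.mp (Set.countable_of_injective_of_countable_image
        luzin_injective.injOn (by rwa [Set.image_univ])))
  · rintro _ ⟨η, rfl⟩
    exact luzin_infinite η
  · rintro _ ⟨ξ, rfl⟩ _ ⟨η, rfl⟩ hne
    exact luzin_inter_finite fun h => hne (by rw [h])

/-! ### The pairing and its crossing colourings -/

/-- The index `2 * α`. -/
def evenIdx (α : Omega1) : Omega1 :=
  ⟨2 * α.1, Ordinal.isPrincipal_mul_omega 1
    (lt_of_lt_of_le (by exact_mod_cast Ordinal.natCast_lt_omega0 2) (Ordinal.omega0_le_omega 1)) α.2⟩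

/-- The index `2 * α + 1`. -/
def oddIdx (α : Omega1) : Omega1 :=
  ⟨2 * α.1 + 1, (Cardinal.isSuccLimit_omega 1).add_one_lt (evenIdx α).2⟩

lemma evenIdx_lt_oddIdx {α β : Omega1} (h : α ≤ β) : evenIdx α < oddIdx β := by
  change 2 * α.1 < 2 * β.1 + 1
  exact Order.lt_add_one_iff.mpr (mul_le_mul_right (show α.1 ≤ β.1 from h) 2)

lemma oddIdx_lt_evenIdx {α β : Omega1} (h : α < β) : oddIdx α < evenIdx β := by
  change 2 * α.1 + 1 < 2 * β.1
  have h1 : α.1 + 1 ≤ β.1 := Order.add_one_le_of_lt h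
  have h2 : 2 * (α.1 + 1) ≤ 2 * β.1 := mul_le_mul_right h1 2
  refine lt_of_lt_of_le ?_ h2
  rw [mul_add, mul_one]
  exact (add_lt_add_iff_left _).mpr one_lt_two

lemma evenIdx_ne_oddIdx (α β : Omega1) : evenIdx α ≠ oddIdx β := by
  rcases le_or_gt α β with h | h
  · exact (evenIdx_lt_oddIdx h).ne
  · exact (oddIdx_lt_evenIdx h).ne'

lemma evenIdx_strictMono : StrictMono evenIdx := fun _ _ h =>
  (evenIdx_lt_oddIdx le_rfl).trans (oddIdx_lt_evenIdx h)

lemma oddIdx_strictMono : StrictMono oddIdx := fun _ _ h =>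
  (oddIdx_lt_evenIdx h).trans (evenIdx_lt_oddIdx le_rfl)

/-- The pairing of the Luzin family. -/
def luzinPair (α : Omega1) : Set ℕ × Set ℕ := (luzin (evenIdx α), luzin (oddIdx α))

lemma isPairing_luzinPair : IsPairing (Set.range luzin) luzinPair := by
  refine ⟨fun α => ⟨⟨_, rfl⟩, ⟨_, rfl⟩, luzin_injective.ne (evenIdx_ne_oddIdx α α)⟩, ?_⟩
  intro α β h
  have h1 := luzin_injective.ne (evenIdx_strictMono.injective.ne h)
  have h2 := luzin_injective.ne (oddIdx_strictMono.injective.ne h)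
  have h3 := luzin_injective.ne (evenIdx_ne_oddIdx α β)
  have h4 := luzin_injective.ne (evenIdx_ne_oddIdx β α).symm
  simp [luzinPair, h1.symm, h2.symm, h3.symm, h4.symm]

/-- A graph on a well-order in which every vertex has finitely many smaller neighbours is
countably chromatic. -/
lemma exists_nat_coloring {ι : Type*} [LinearOrder ι] [WellFoundedLT ι] (R : ι → ι → Prop)
    (hR : ∀ β, {α | α < β ∧ R α β}.Finite) :
    ∃ χ : ι → ℕ, ∀ α β, α < β → χ α = χ β → ¬ R α β := by
  -- Greedy colouring: the least colour not used by a smaller neighbour.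
  let χ : ι → ℕ := wellFounded_lt.fix fun β F =>
    sInf {n | ∀ α (h : α < β), R α β → F α h ≠ n}
  have hfix : ∀ β, χ β = sInf {n | ∀ α, α < β → R α β → χ α ≠ n} := by
    intro β
    change wellFounded_lt.fix _ β = _
    rw [WellFounded.fix_eq]
  refine ⟨χ, fun α β h hχ hRαβ => ?_⟩
  have hne : {n | ∀ α, α < β → R α β → χ α ≠ n}.Nonempty := by
    obtain ⟨n, hn⟩ := ((hR β).image χ).exists_notMem
    exact ⟨n, fun α h hr hc => hn ⟨α, ⟨h, hr⟩, hc⟩⟩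
  have := Nat.sInf_mem hne
  rw [← hfix] at this
  exact this α h hRαβ hχ

/-- Join `α < β` when `A_{2α}` and `A_{2β+1}` do not meet in `[n, ∞)`. The maximum of the
intersection is then at most `n`, so the Luzin property leaves finitely many such `α` for each `β`.
-/
lemma exists_luzinPair_coloring (n : ℕ) : ∃ χ : Omega1 → ℕ, ∀ α β, α ≠ β → χ α = χ β →
    ∃ p ≥ n, (p ∈ (luzinPair α).1 ∧ p ∈ (luzinPair β).2) ∨
      (p ∈ (luzinPair α).2 ∧ p ∈ (luzinPair β).1) := by
  obtain ⟨χ, hχ⟩ := exists_nat_coloring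
    (fun α β => ∀ p ≥ n, ¬ (p ∈ luzin (evenIdx α) ∧ p ∈ luzin (oddIdx β))) (by
      intro β
      have hfin : (⋃ m ∈ {m | m ≤ n},
          {ξ | ξ < oddIdx β ∧ sSup (luzin ξ ∩ luzin (oddIdx β)) = m}).Finite :=
        (Set.finite_le_nat n).biUnion fun m _ => finite_sSup_luzin_inter (oddIdx β) m
      refine (hfin.preimage evenIdx_strictMono.injective.injOn).subset ?_
      rintro α ⟨h, hα⟩
      have hle : sSup (luzin (evenIdx α) ∩ luzin (oddIdx β)) ≤ n := by
        refine csSup_le' fun p hp => ?_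
        by_contra hc
        exact hα p (not_le.mp hc).le hp
      exact Set.mem_biUnion (show _ ∈ {m | m ≤ n} from hle) ⟨evenIdx_lt_oddIdx h.le, rfl⟩)
  refine ⟨χ, fun α β hne hc => ?_⟩
  rcases lt_or_gt_of_ne hne with h | h
  · have := hχ α β h hc
    push Not at this
    obtain ⟨p, hp, h⟩ := this
    exact ⟨p, hp, Or.inl h⟩
  · have := hχ β α h hc.symm
    push Not at this
    obtain ⟨p, hp, h⟩ := this
    exact ⟨p, hp, Or.inr h.symm⟩

/-! ### The subspace `c₀` of `ℓ∞` -/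

lemma isClosed_cZero : IsClosed (cZero : Set Linfty) := by
  rw [← isSeqClosed_iff_isClosed]
  intro u f hu hf
  change Filter.Tendsto (fun n : ℕ => f n) Filter.atTop (𝓝 0)
  rw [Metric.tendsto_atTop]
  intro ε hε
  obtain ⟨m, hm⟩ := (Metric.tendsto_atTop.mp hf (ε / 2) (half_pos hε))
  obtain ⟨N, hN⟩ := Metric.tendsto_atTop.mp (hu m) (ε / 2) (half_pos hε)
  refine ⟨N, fun n hn => ?_⟩
  have h1 := hm m le_rfl
  have h2 := hN n hn
  have h3 := lp.norm_apply_le_norm (by simp) (u m - f) n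
  rw [dist_eq_norm] at h1
  simp only [Real.dist_eq, sub_zero, Real.norm_eq_abs, lp.coeFn_sub, Pi.sub_apply] at *
  rw [abs_lt] at *
  rw [abs_le] at h3
  constructor <;> linarith [h2.1, h2.2, h3.1, h3.2]

lemma sum_coe_apply {ι : Type*} (s : Finset ι) (f : ι → Linfty) (p : ℕ) :
    (∑ i ∈ s, f i : Linfty) p = ∑ i ∈ s, f i p := by
  classical
  induction s using Finset.induction_on with
  | empty => simp
  | insert a s ha ih =>
    rw [Finset.sum_insert ha, Finset.sum_insert ha, ← ih]
    rfl

/-- The restriction of a bounded sequence to the coordinates below `N`. -/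
noncomputable def truncate (N : ℕ) (w : Linfty) : Linfty :=
  ∑ i ∈ Finset.range N, w i • lp.single ∞ i (1 : ℝ)

lemma truncate_apply (N : ℕ) (w : Linfty) (p : ℕ) :
    truncate N w p = if p < N then w p else 0 := by
  rw [truncate, sum_coe_apply]
  have : ∀ i, (w i • lp.single ∞ i (1 : ℝ) : Linfty) p = if p = i then w i else 0 := by
    intro i
    change w i * (lp.single ∞ i (1 : ℝ) : Linfty) p = _
    rw [lp.single_apply, Pi.single_apply]
    simp
  simp [this]

lemma truncate_mem_cZero (N : ℕ) (w : Linfty) : truncate N w ∈ cZero := by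
  refine tendsto_const_nhds.congr' ?_
  filter_upwards [Filter.eventually_ge_atTop N] with p hp
  simp [truncate_apply, hp.not_gt]

lemma norm_sub_truncate_le {N : ℕ} {w : Linfty} {t : ℝ} (ht : 0 ≤ t)
    (h : ∀ p ≥ N, |w p| ≤ t) : ‖w - truncate N w‖ ≤ t := by
  refine lp.norm_le_of_forall_le ht fun p => ?_
  rw [lp.coeFn_sub, Pi.sub_apply, truncate_apply]
  split_ifs with hp
  · simpa
  · simpa using h p (not_lt.mp hp)

lemma isSeparable_cZero : TopologicalSpace.IsSeparable (cZero : Set Linfty) := by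
  have hs : TopologicalSpace.IsSeparable
      (Submodule.span ℝ (Set.range fun i : ℕ => (lp.single ∞ i (1 : ℝ) : Linfty)) : Set Linfty) :=
    (Set.countable_range _).isSeparable.span
  refine hs.closure.mono fun f hf => ?_
  rw [Metric.mem_closure_iff]
  intro ε hε
  obtain ⟨N, hN⟩ := Metric.tendsto_atTop.mp hf (ε / 2) (half_pos hε)
  refine ⟨truncate N f, ?_, ?_⟩
  · exact Submodule.sum_mem _ fun i _ => Submodule.smul_mem _ _ (Submodule.subset_span ⟨i, rfl⟩)
  · rw [dist_eq_norm]
    refine (norm_sub_truncate_le (half_pos hε).le fun p hp => ?_).trans_lt (half_lt_self hε)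
    simpa using (hN p hp).le

/-! ### Quotient norms modulo `c₀` -/

section Quotient

variable {X : Submodule ℝ Linfty}

/-- The subspace `c₀` of a subspace of `ℓ∞`. -/
noncomputable def cZeroIn (X : Submodule ℝ Linfty) : Submodule ℝ X := cZero.comap X.subtype

/-- Subtracting the truncation below `N`, an element of `c₀`, removes the uncontrolled coordinates
without changing the class. -/
lemma norm_mkQ_le (hX : cZero ≤ X) {w : X} {N : ℕ} {t : ℝ} (ht : 0 ≤ t)
    (h : ∀ p ≥ N, |(w : Linfty) p| ≤ t) : ‖(cZeroIn X).mkQ w‖ ≤ t := by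
  let y : X := ⟨truncate N w, hX (truncate_mem_cZero N w)⟩
  have hy : y ∈ cZeroIn X := truncate_mem_cZero N w
  have : (cZeroIn X).mkQ w = (cZeroIn X).mkQ (w - y) := by
    rw [map_sub, (Submodule.Quotient.mk_eq_zero _).mpr hy |> fun h : (cZeroIn X).mkQ y = 0 => h,
      sub_zero]
  rw [this]
  exact (Submodule.Quotient.norm_mk_le _ _).trans (norm_sub_truncate_le ht h)

/-- A representative of almost minimal norm differs from `w` by a null sequence, so far out along
`A` it is still near `c`. -/
lemma abs_le_of_norm_mkQ_le {w : X} {A : Set ℕ} (hA : A.Infinite) {k : ℕ} {c s t : ℝ}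
    (hw : ‖(cZeroIn X).mkQ w‖ ≤ t) (h : ∀ p ∈ A, k ≤ p → |(w : Linfty) p - c| ≤ s) :
    |c| ≤ t + s := by
  refine le_of_forall_pos_le_add fun ε hε => ?_
  obtain ⟨m, hm, hmt⟩ := Submodule.Quotient.norm_mk_lt ((cZeroIn X).mkQ w) (half_pos hε)
  have hmem : m - w ∈ cZeroIn X := (Submodule.Quotient.eq _).mp hm
  obtain ⟨N, hN⟩ := Metric.tendsto_atTop.mp (show Filter.Tendsto
    (fun n : ℕ => ((m - w : X) : Linfty) n) Filter.atTop (𝓝 0) from hmem) (ε / 2) (half_pos hε)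
  obtain ⟨p, hpA, hp⟩ := hA.exists_gt (max k N)
  have h1 := hN p ((le_max_right _ _).trans hp.le)
  have h2 := h p hpA ((le_max_left _ _).trans hp.le)
  have h3 := lp.norm_apply_le_norm (by simp) (m : Linfty) p
  have h4 : ‖(m : Linfty)‖ < ‖(cZeroIn X).mkQ w‖ + ε / 2 := hmt
  simp only [Real.dist_eq, sub_zero, Real.norm_eq_abs, Submodule.coe_sub, lp.coeFn_sub,
    Pi.sub_apply] at *
  have := abs_lt.mp h1
  have := abs_le.mp h2
  have := abs_le.mp h3
  rw [abs_le]
  constructor <;> linarith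

end Quotient

/-! ### Integer codes and their types -/

section Coding

variable {ι : Type*} (φ : ι → Set ℕ × Set ℕ)

/-- The generator `1_{φ₁(α)} - 1_{φ₋₁(α)}`. -/
noncomputable def pairFn (α : ι) : Linfty := charFn (φ α).1 - charFn (φ α).2

open Classical in
lemma pairFn_apply (α : ι) (p : ℕ) : pairFn φ α p =
    (if p ∈ (φ α).1 then 1 else 0) - (if p ∈ (φ α).2 then 1 else 0) := by
  change (φ α).1.indicator (fun _ => (1 : ℝ)) p - (φ α).2.indicator (fun _ => (1 : ℝ)) p = _
  simp only [Set.indicator_apply]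

/-- All sets in all pairs are almost disjoint from each other. -/
structure AlmostDisjointPairs : Prop where
  fst : Pairwise fun α β => ((φ α).1 ∩ (φ β).1).Finite
  snd : Pairwise fun α β => ((φ α).2 ∩ (φ β).2).Finite
  fst_snd : ∀ α β, ((φ α).1 ∩ (φ β).2).Finite

/-- The sets in the pairs indexed by `F` are disjoint on `[k, ∞)`. -/
def DisjointFrom (k : ℕ) (F : Finset ι) : Prop :=
  ∀ p ≥ k, ∀ α ∈ F, ∀ β ∈ F, (p ∈ (φ α).1 → p ∈ (φ β).1 → α = β) ∧
    (p ∈ (φ α).2 → p ∈ (φ β).2 → α = β) ∧ (p ∈ (φ α).1 → p ∉ (φ β).2)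

variable {φ}

lemma DisjointFrom.mono {k l : ℕ} {F G : Finset ι} (h : DisjointFrom φ k F) (hkl : k ≤ l)
    (hG : G ⊆ F) : DisjointFrom φ l G :=
  fun p hp α hα β hβ => h p (hkl.trans hp) α (hG hα) β (hG hβ)

lemma AlmostDisjointPairs.exists_disjointFrom (hφ : AlmostDisjointPairs φ) (F : Finset ι) :
    ∃ k, DisjointFrom φ k F := by
  have key : ∀ α β, ∀ᶠ p in Filter.atTop, (p ∈ (φ α).1 → p ∈ (φ β).1 → α = β) ∧
      (p ∈ (φ α).2 → p ∈ (φ β).2 → α = β) ∧ (p ∈ (φ α).1 → p ∉ (φ β).2) := by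
    intro α β
    have hev : ∀ {S : Set ℕ}, S.Finite → ∀ᶠ p in Filter.atTop, p ∉ S := by
      intro S hS
      rw [← Nat.cofinite_eq_atTop]
      exact hS.eventually_cofinite_notMem
    have h3 := hev (hφ.fst_snd α β)
    by_cases hab : α = β
    · filter_upwards [h3] with p hp
      exact ⟨fun _ _ => hab, fun _ _ => hab, fun h h' => hp ⟨h, h'⟩⟩
    · filter_upwards [h3, hev (hφ.fst hab), hev (hφ.snd hab)] with p hp h1 h2
      exact ⟨fun h h' => absurd ⟨h, h'⟩ h1, fun h h' => absurd ⟨h, h'⟩ h2,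
        fun h h' => hp ⟨h, h'⟩⟩
  have := (Filter.eventually_all_finset F).mpr fun α _ =>
    (Filter.eventually_all_finset F).mpr fun β _ => key α β
  exact Filter.eventually_atTop.mp this

lemma linearCombination_pairFn_apply (r : ι →₀ ℝ) (p : ℕ) :
    (Finsupp.linearCombination ℝ (pairFn φ) r) p = ∑ α ∈ r.support, r α * pairFn φ α p := by
  rw [Finsupp.linearCombination_apply, Finsupp.sum, sum_coe_apply]
  rfl

lemma DisjointFrom.linearCombination_fst {k : ℕ} {r : ι →₀ ℝ} (h : DisjointFrom φ k r.support)
    {p : ℕ} (hp : k ≤ p) {γ : ι} (hγ : γ ∈ r.support) (hpγ : p ∈ (φ γ).1) :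
    (Finsupp.linearCombination ℝ (pairFn φ) r) p = r γ := by
  rw [linearCombination_pairFn_apply, Finset.sum_eq_single_of_mem γ hγ]
  · simp [pairFn_apply, hpγ, (h p hp γ hγ γ hγ).2.2 hpγ]
  · intro β hβ hne
    have h1 := (h p hp γ hγ β hβ)
    have h2 : p ∉ (φ β).1 := fun h => hne (h1.1 hpγ h).symm
    simp [pairFn_apply, h1.2.2 hpγ, h2]

lemma DisjointFrom.linearCombination_snd {k : ℕ} {r : ι →₀ ℝ} (h : DisjointFrom φ k r.support)
    {p : ℕ} (hp : k ≤ p) {γ : ι} (hγ : γ ∈ r.support) (hpγ : p ∈ (φ γ).2) :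
    (Finsupp.linearCombination ℝ (pairFn φ) r) p = - r γ := by
  rw [linearCombination_pairFn_apply, Finset.sum_eq_single_of_mem γ hγ]
  · have h2 : p ∉ (φ γ).1 := fun h' => (h p hp γ hγ γ hγ).2.2 h' hpγ
    simp [pairFn_apply, hpγ, h2]
  · intro β hβ hne
    have h1 := (h p hp γ hγ β hβ)
    have h2 : p ∉ (φ β).1 := fun h' => (h p hp β hβ γ hγ).2.2 h' hpγ
    have h3 : p ∉ (φ β).2 := fun h => hne (h1.2.1 hpγ h).symm
    simp [pairFn_apply, h2, h3]

lemma linearCombination_eq_zero {r : ι →₀ ℝ} {p : ℕ}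
    (h : ∀ γ ∈ r.support, p ∉ (φ γ).1 ∧ p ∉ (φ γ).2) :
    (Finsupp.linearCombination ℝ (pairFn φ) r) p = 0 := by
  rw [linearCombination_pairFn_apply]
  exact Finset.sum_eq_zero fun γ hγ => by simp [pairFn_apply, h γ hγ]

lemma exists_linearCombination_approx {z : Linfty} (hz : z ∈ spaceXPairing φ) {ε : ℝ}
    (hε : 0 < ε) : ∃ (r : ι →₀ ℝ) (k : ℕ), ∀ p ≥ k,
      |z p - (Finsupp.linearCombination ℝ (pairFn φ) r) p| ≤ ε := by
  have hz' : z ∈ closure (Submodule.span ℝ ((cZero : Set Linfty) ∪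
    Set.range (pairFn φ)) : Set Linfty) := hz
  obtain ⟨w, hw, hzw⟩ := Metric.mem_closure_iff.mp hz' (ε / 2) (half_pos hε)
  rw [Submodule.span_union, Submodule.span_eq, SetLike.mem_coe, Submodule.mem_sup] at hw
  obtain ⟨f, hf, g, hg, rfl⟩ := hw
  obtain ⟨r, rfl⟩ := (Finsupp.mem_span_range_iff_exists_finsupp).mp hg
  obtain ⟨N, hN⟩ := Metric.tendsto_atTop.mp hf (ε / 2) (half_pos hε)
  refine ⟨r, N, fun p hp => ?_⟩
  have h1 := hN p hp
  rw [dist_eq_norm] at hzw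
  have h2 := lp.norm_apply_le_norm (by simp) _ p |>.trans hzw.le
  rw [← Finsupp.linearCombination_apply] at h2
  simp only [Real.dist_eq, sub_zero, Real.norm_eq_abs, lp.coeFn_sub, lp.coeFn_add,
    Pi.sub_apply, Pi.add_apply] at h1 h2
  have := abs_lt.mp h1
  have := abs_le.mp h2
  rw [abs_le]
  constructor <;> linarith

/-- On `[k, ∞)` the sequence `z` is within `2 * ε` of the combination of the generators with
coefficients `ε * q α`, and the sets involved are disjoint there. -/
structure IsCode (φ : ι → Set ℕ × Set ℕ) (ε : ℝ) (z : Linfty) (k : ℕ) (q : ι →₀ ℤ) : Prop where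
  disjointFrom : DisjointFrom φ k q.support
  fst : ∀ p ≥ k, ∀ γ ∈ q.support, p ∈ (φ γ).1 → |z p - ε * q γ| ≤ 2 * ε
  snd : ∀ p ≥ k, ∀ γ ∈ q.support, p ∈ (φ γ).2 → |z p + ε * q γ| ≤ 2 * ε
  zero : ∀ p ≥ k, (∀ γ ∈ q.support, p ∉ (φ γ).1 ∧ p ∉ (φ γ).2) → |z p| ≤ 2 * ε

lemma abs_sub_mul_floor_le {ε : ℝ} (hε : 0 < ε) (x : ℝ) : |x - ε * ⌊x / ε⌋| ≤ ε := by
  have h1 := Int.floor_le (x / ε)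
  have h2 := (Int.lt_floor_add_one (x / ε)).le
  rw [le_div_iff₀ hε] at h1
  rw [div_le_iff₀ hε] at h2
  rw [abs_le]
  constructor <;> nlinarith

/-- One `ε` in the error pays for the approximation by a finite combination, the other for rounding
its coefficients down to multiples of `ε`. -/
lemma AlmostDisjointPairs.exists_isCode (hφ : AlmostDisjointPairs φ) {z : Linfty}
    (hz : z ∈ spaceXPairing φ) {ε : ℝ} (hε : 0 < ε) : ∃ k q, IsCode φ ε z k q := by
  obtain ⟨r, k, hk⟩ := exists_linearCombination_approx hz hε
  obtain ⟨l, hl⟩ := hφ.exists_disjointFrom r.support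
  let q : ι →₀ ℤ := r.mapRange (fun x => ⌊x / ε⌋) (by simp)
  have hsub : q.support ⊆ r.support := Finsupp.support_mapRange
  have hq : ∀ γ, |r γ - ε * q γ| ≤ ε := fun γ => by
    simpa [q] using abs_sub_mul_floor_le hε (r γ)
  have hfst : ∀ p ≥ max k l, ∀ γ ∈ r.support, p ∈ (φ γ).1 → |z p - ε * q γ| ≤ 2 * ε := by
    intro p hp γ hγ hpγ
    have h1 := hk p ((le_max_left _ _).trans hp)
    rw [hl.linearCombination_fst ((le_max_right _ _).trans hp) hγ hpγ] at h1
    have := abs_le.mp h1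
    have := abs_le.mp (hq γ)
    rw [abs_le]
    constructor <;> linarith
  have hsnd : ∀ p ≥ max k l, ∀ γ ∈ r.support, p ∈ (φ γ).2 → |z p + ε * q γ| ≤ 2 * ε := by
    intro p hp γ hγ hpγ
    have h1 := hk p ((le_max_left _ _).trans hp)
    rw [hl.linearCombination_snd ((le_max_right _ _).trans hp) hγ hpγ] at h1
    have := abs_le.mp h1
    have := abs_le.mp (hq γ)
    rw [abs_le]
    constructor <;> linarith
  refine ⟨max k l, q, hl.mono (le_max_right _ _) hsub,
    fun p hp γ hγ => hfst p hp γ (hsub hγ), fun p hp γ hγ => hsnd p hp γ (hsub hγ), ?_⟩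
  intro p hp hnone
  -- Rounding may turn coefficients into `0`, so `p` can avoid the pairs of `q` and still lie in a
  -- pair of `r`.
  by_cases h : ∃ γ ∈ r.support, p ∈ (φ γ).1 ∨ p ∈ (φ γ).2
  · obtain ⟨γ, hγ, hpγ⟩ := h
    have hq0 : q γ = 0 := by
      by_contra hne
      have := hnone γ (Finsupp.mem_support_iff.mpr hne)
      tauto
    rcases hpγ with hpγ | hpγ
    · simpa [hq0] using hfst p hp γ hγ hpγ
    · simpa [hq0] using hsnd p hp γ hγ hpγ
  · push Not at h
    have h1 := hk p ((le_max_left _ _).trans hp)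
    rw [linearCombination_eq_zero h, sub_zero] at h1
    linarith

/-- Past the point where the pairs occurring in two codes are disjoint, the difference of the coded
sequences is bounded by the differences of the codes. -/
lemma IsCode.exists_abs_sub_le (hφ : AlmostDisjointPairs φ) {ε t : ℝ} {z z' : Linfty} {k k' : ℕ}
    {q q' : ι →₀ ℤ} (h : IsCode φ ε z k q) (h' : IsCode φ ε z' k' q') (ht : 0 ≤ t)
    (hqq : ∀ γ, |ε * q γ - ε * q' γ| ≤ t) : ∃ N, ∀ p ≥ N, |z p - z' p| ≤ t + 4 * ε := by
  classical
  obtain ⟨l, hl⟩ := hφ.exists_disjointFrom (q.support ∪ q'.support)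
  have hfst : ∀ {z : Linfty} {k : ℕ} {q₁ : ι →₀ ℤ}, IsCode φ ε z k q₁ →
      q₁.support ⊆ q.support ∪ q'.support → ∀ p ≥ k, p ≥ l → ∀ γ ∈ q.support ∪ q'.support,
      p ∈ (φ γ).1 → |z p - ε * q₁ γ| ≤ 2 * ε := by
    intro z k q₁ hc hsub p hpk hpl γ hγ hpγ
    by_cases hmem : γ ∈ q₁.support
    · exact hc.fst p hpk γ hmem hpγ
    -- Here `γ` belongs only to the other code; disjointness past `l` keeps `p` out of every pair of
    -- this one.
    · rw [Finsupp.notMem_support_iff.mp hmem]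
      have := hc.zero p hpk fun β hβ => by
        have hd := hl p hpl γ hγ β (hsub hβ)
        exact ⟨fun hb => hmem (hd.1 hpγ hb ▸ hβ), hd.2.2 hpγ⟩
      simpa using this
  have hsnd : ∀ {z : Linfty} {k : ℕ} {q₁ : ι →₀ ℤ}, IsCode φ ε z k q₁ →
      q₁.support ⊆ q.support ∪ q'.support → ∀ p ≥ k, p ≥ l → ∀ γ ∈ q.support ∪ q'.support,
      p ∈ (φ γ).2 → |z p + ε * q₁ γ| ≤ 2 * ε := by
    intro z k q₁ hc hsub p hpk hpl γ hγ hpγ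
    by_cases hmem : γ ∈ q₁.support
    · exact hc.snd p hpk γ hmem hpγ
    · rw [Finsupp.notMem_support_iff.mp hmem]
      have := hc.zero p hpk fun β hβ => by
        have hd := hl p hpl γ hγ β (hsub hβ)
        exact ⟨fun hb => (hl p hpl β (hsub hβ) γ hγ).2.2 hb hpγ,
          fun hb => hmem (hd.2.1 hpγ hb ▸ hβ)⟩
      simpa using this
  refine ⟨max l (max k k'), fun p hp => ?_⟩
  simp only [ge_iff_le, max_le_iff] at hp
  obtain ⟨hpl, hpk, hpk'⟩ := hp
  by_cases hex : ∃ γ ∈ q.support ∪ q'.support, p ∈ (φ γ).1 ∨ p ∈ (φ γ).2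
  · obtain ⟨γ, hγ, hpγ⟩ := hex
    have h3 := abs_le.mp (hqq γ)
    rcases hpγ with hpγ | hpγ
    · have h1 := abs_le.mp (hfst h Finset.subset_union_left p hpk hpl γ hγ hpγ)
      have h2 := abs_le.mp (hfst h' Finset.subset_union_right p hpk' hpl γ hγ hpγ)
      rw [abs_le]
      constructor <;> linarith
    · have h1 := abs_le.mp (hsnd h Finset.subset_union_left p hpk hpl γ hγ hpγ)
      have h2 := abs_le.mp (hsnd h' Finset.subset_union_right p hpk' hpl γ hγ hpγ)
      rw [abs_le]
      constructor <;> linarith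
  · push Not at hex
    have h1 := abs_le.mp (h.zero p hpk fun γ hγ => hex γ (Finset.mem_union_left _ hγ))
    have h2 := abs_le.mp (h'.zero p hpk' fun γ hγ => hex γ (Finset.mem_union_right _ hγ))
    rw [abs_le]
    constructor <;> linarith

/-- Indices of the same colour have pairs that cross past `k`. -/
def IsCrossingColoring (φ : ι → Set ℕ × Set ℕ) (k : ℕ) (χ : ι → ℕ) : Prop :=
  ∀ α β, α ≠ β → χ α = χ β →
    ∃ p ≥ k, (p ∈ (φ α).1 ∧ p ∈ (φ β).2) ∨ (p ∈ (φ α).2 ∧ p ∈ (φ β).1)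

/-- Crossing past `k` contradicts disjointness past `k`. Hence pushing a code forward along `χ`
merges no coefficients. -/
lemma IsCrossingColoring.injOn {k : ℕ} {χ : ι → ℕ} (hχ : IsCrossingColoring φ k χ)
    {F : Finset ι} (hF : DisjointFrom φ k F) : Set.InjOn χ F := by
  intro α hα β hβ h
  by_contra hne
  obtain ⟨p, hp, h | h⟩ := hχ α β hne h
  · exact (hF p hp α hα β hβ).2.2 h.1 h.2
  · exact (hF p hp β hβ α hα).2.2 h.2 h.1

lemma IsCrossingColoring.mapDomain_apply {k : ℕ} {χ : ι → ℕ} (hχ : IsCrossingColoring φ k χ)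
    {q : ι →₀ ℤ} (hq : DisjointFrom φ k q.support) {γ : ι} (hγ : γ ∈ q.support) :
    q.mapDomain χ (χ γ) = q γ :=
  Finsupp.mapDomain_apply' _ q subset_rfl (hχ.injOn hq) hγ

/-- Codes of the same type agree on the intersection of their supports. -/
lemma IsCrossingColoring.eq_of_mem_support {k : ℕ} {χ : ι → ℕ} (hχ : IsCrossingColoring φ k χ)
    {q q' : ι →₀ ℤ} (hq : DisjointFrom φ k q.support) (hq' : DisjointFrom φ k q'.support)
    (heq : q.mapDomain χ = q'.mapDomain χ) {γ : ι} (hγ : γ ∈ q.support) (hγ' : γ ∈ q'.support) :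
    q γ = q' γ := by
  rw [← hχ.mapDomain_apply hq hγ, heq, hχ.mapDomain_apply hq' hγ']

/-- A coordinate of a code that does not occur in another code of the same type forces the coded
sequences apart. -/
lemma IsCode.exists_le_abs_sub {ε : ℝ} {z z' : Linfty} {k : ℕ} {χ : ι → ℕ}
    (hχ : IsCrossingColoring φ k χ) {q q' : ι →₀ ℤ} (h : IsCode φ ε z k q)
    (h' : IsCode φ ε z' k q') (heq : q.mapDomain χ = q'.mapDomain χ) {γ : ι}
    (hγ : γ ∈ q.support) (hγ' : γ ∉ q'.support) :
    ∃ p, 2 * |ε * q γ| - 4 * ε ≤ |z p - z' p| := by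
  classical
  have hval := hχ.mapDomain_apply h.disjointFrom hγ
  have hmem : χ γ ∈ (q'.mapDomain χ).support := by
    rw [Finsupp.mem_support_iff, ← heq, hval]
    exact Finsupp.mem_support_iff.mp hγ
  -- `β` carries in `q'` the coefficient that `γ` carries in `q`; where their pairs cross, it enters
  -- with opposite signs.
  obtain ⟨β, hβ, hχβ⟩ := Finset.mem_image.mp (Finsupp.mapDomain_support hmem)
  have hne : γ ≠ β := fun h => hγ' (h ▸ hβ)
  have hβval : q' β = q γ := by
    rw [← hval, heq, ← hχβ, hχ.mapDomain_apply h'.disjointFrom hβ]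
  obtain ⟨p, hp, ⟨h1, h2⟩ | ⟨h1, h2⟩⟩ := hχ γ β hne hχβ.symm
  · have e1 := abs_le.mp (h.fst p hp γ hγ h1)
    have e2 := abs_le.mp (h'.snd p hp β hβ h2)
    rw [hβval] at e2
    refine ⟨p, ?_⟩
    rcases abs_cases (ε * (q γ : ℝ)) with ⟨ha, _⟩ | ⟨ha, _⟩ <;>
    rcases abs_cases (z p - z' p) with ⟨hb, _⟩ | ⟨hb, _⟩ <;> rw [ha, hb] <;> linarith
  · have e1 := abs_le.mp (h.snd p hp γ hγ h1)
    have e2 := abs_le.mp (h'.fst p hp β hβ h2)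
    rw [hβval] at e2
    refine ⟨p, ?_⟩
    rcases abs_cases (ε * (q γ : ℝ)) with ⟨ha, _⟩ | ⟨ha, _⟩ <;>
    rcases abs_cases (z p - z' p) with ⟨hb, _⟩ | ⟨hb, _⟩ <;> rw [ha, hb] <;> linarith

end Coding

/-! ### Separation in `𝒳` and in `𝒳 / c₀` -/

section Separation

variable {ι : Type*} {φ : ι → Set ℕ × Set ℕ}

lemma cZero_le_spaceXPairing : cZero ≤ spaceXPairing φ := fun _ hf =>
  Submodule.le_topologicalClosure _ (Submodule.subset_span (Or.inl hf))

lemma pairFn_mem_spaceXPairing (α : ι) : pairFn φ α ∈ spaceXPairing φ :=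
  Submodule.le_topologicalClosure _ (Submodule.subset_span (Or.inr ⟨α, rfl⟩))

/-- The elements of `𝒳_{𝒜,φ}` have countably many types, given by codes and colourings. -/
lemma exists_code_type (hφ : AlmostDisjointPairs φ)
    {χ : ℕ → ι → ℕ} {ε : ℝ} (hε : 0 < ε) :
    ∃ (k : spaceXPairing φ → ℕ) (q : spaceXPairing φ → ι →₀ ℤ) (τ : spaceXPairing φ → ℕ),
      (∀ z : spaceXPairing φ, IsCode φ ε z (k z) (q z)) ∧
      ∀ z z', τ z = τ z' → k z = k z' ∧
        (q z).mapDomain (χ (k z)) = (q z').mapDomain (χ (k z)) := by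
  choose k q hkq using fun z : spaceXPairing φ => hφ.exists_isCode z.2 hε
  -- Countability enters here: colours in `ℕ` replace the indices in `ι`.
  obtain ⟨f, hf⟩ := exists_injective_nat (ℕ × (ℕ →₀ ℤ))
  refine ⟨k, q, fun z => f (k z, (q z).mapDomain (χ (k z))), hkq, fun z z' h => ?_⟩
  have := hf h
  rw [Prod.mk.injEq] at this
  obtain ⟨h1, h2⟩ := this
  exact ⟨h1, by rw [h2, h1]⟩

lemma IsCode.norm_mkQ_sub_le (hφ : AlmostDisjointPairs φ) {ε t : ℝ} (hε : 0 < ε)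
    {z z' : spaceXPairing φ} {k k' : ℕ}
    {q q' : ι →₀ ℤ} (h : IsCode φ ε z k q) (h' : IsCode φ ε z' k' q') (ht : 0 ≤ t)
    (hqq : ∀ γ, |ε * q γ - ε * q' γ| ≤ t) :
    ‖(cZeroIn (spaceXPairing φ)).mkQ z - (cZeroIn (spaceXPairing φ)).mkQ z'‖ ≤ t + 4 * ε := by
  obtain ⟨N, hN⟩ := h.exists_abs_sub_le hφ h' ht hqq
  rw [← map_sub]
  exact norm_mkQ_le cZero_le_spaceXPairing (by positivity) (N := N) hN

theorem exists_countable_separated_cover (hφ : AlmostDisjointPairs φ)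
    (hχ : ∀ k, ∃ χ, IsCrossingColoring φ k χ) {δ : ℝ} (hδ : 0 < δ) :
    ∃ ε : ℝ, 0 < ε ∧ ∀ Z : Set (spaceXPairing φ),
      Set.InjOn (cZeroIn (spaceXPairing φ)).mkQ Z →
      IsSeparatedBy (1 - ε) ((cZeroIn (spaceXPairing φ)).mkQ '' Z) →
      ∃ S : ℕ → Set (spaceXPairing φ), Z = ⋃ n, S n ∧ ∀ n, IsSeparatedBy (2 - δ) (S n) := by
  choose χ hχ using hχ
  -- The bound `d ≤ 1` makes the threshold `1 - d / 4 - 5 * (d / 40)` nonnegative.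
  obtain ⟨d, hd0, hd1, hdδ⟩ : ∃ d : ℝ, 0 < d ∧ d ≤ 1 ∧ d ≤ δ :=
    ⟨min 1 δ, lt_min one_pos hδ, min_le_left _ _, min_le_right _ _⟩
  have hε : 0 < d / 40 := by positivity
  refine ⟨d / 4, by positivity, fun Z hinj hsep => ?_⟩
  obtain ⟨k, q, τ, hcode, hτ⟩ := exists_code_type hφ (χ := χ) hε
  refine ⟨fun n => {z ∈ Z | τ z = n}, by ext z; simp, ?_⟩
  rintro n z ⟨hz, hzn⟩ z' ⟨hz', hzn'⟩ hne
  obtain ⟨hk, hmap⟩ := hτ z z' (hzn.trans hzn'.symm)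
  have hc := hcode z
  have hc' := hcode z'
  rw [← hk] at hc'
  have hsepz := hsep ⟨z, hz, rfl⟩ ⟨z', hz', rfl⟩ (hinj.ne hz hz' hne)
  -- Otherwise the classes would be at distance at most `1 - d / 4 - d / 40`. Doubling this
  -- threshold and losing `4 * (d / 40)` leaves `2 - 17 * d / 20 ≥ 2 - δ`.
  obtain ⟨γ, hγ⟩ : ∃ γ, 1 - d / 4 - 5 * (d / 40) < |d / 40 * q z γ - d / 40 * q z' γ| := by
    by_contra! hcon
    have := hc.norm_mkQ_sub_le hφ hε hc' (by linarith) hcon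
    linarith
  have hfin : ∃ p, 2 - δ ≤ |(z : Linfty) p - (z' : Linfty) p| := by
    by_cases h1 : γ ∈ (q z).support <;> by_cases h2 : γ ∈ (q z').support
    · rw [(hχ _).eq_of_mem_support hc.disjointFrom hc'.disjointFrom hmap h1 h2, sub_self,
        abs_zero] at hγ
      linarith
    · obtain ⟨p, hp⟩ := hc.exists_le_abs_sub (hχ _) hc' hmap h1 h2
      refine ⟨p, le_trans ?_ hp⟩
      rw [Finsupp.notMem_support_iff.mp h2, Int.cast_zero, mul_zero, sub_zero] at hγ
      linarith
    · obtain ⟨p, hp⟩ := hc'.exists_le_abs_sub (hχ _) hc hmap.symm h2 h1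
      rw [abs_sub_comm] at hp
      refine ⟨p, le_trans ?_ hp⟩
      rw [Finsupp.notMem_support_iff.mp h1, Int.cast_zero, mul_zero, zero_sub, abs_neg] at hγ
      linarith
    · rw [Finsupp.notMem_support_iff.mp h1, Finsupp.notMem_support_iff.mp h2, sub_self,
        abs_zero] at hγ
      linarith
  obtain ⟨p, hp⟩ := hfin
  exact hp.trans (lp.norm_apply_le_norm (by simp) ((z - z' : spaceXPairing φ) : Linfty) p)

theorem countable_of_separated_quotient (hφ : AlmostDisjointPairs φ)
    (hinf : ∀ α, (φ α).1.Infinite) (hχ : ∀ k, ∃ χ, IsCrossingColoring φ k χ)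
    {ε : ℝ} (hε : 0 < ε) {W : Set (spaceXPairing φ ⧸ cZeroIn (spaceXPairing φ))}
    (hW : W ⊆ Metric.closedBall 0 1) (hsep : IsSeparatedBy (1 + ε) W) : W.Countable := by
  choose χ hχ using hχ
  have hε' : 0 < ε / 10 := by positivity
  obtain ⟨k, q, τ, hcode, hτ⟩ := exists_code_type hφ (χ := χ) hε'
  choose rep hrep using (cZeroIn (spaceXPairing φ)).mkQ_surjective
  -- It suffices that no two points of `W` have representatives of the same type.
  suffices h : Set.InjOn (fun w => τ (rep w)) W from
    Set.countable_of_injective_of_countable_image h (Set.to_countable _)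
  intro w hw w' hw' hww
  by_contra hne
  obtain ⟨hk, hmap⟩ := hτ _ _ hww
  have hc := hcode (rep w)
  have hc' := hcode (rep w')
  rw [← hk] at hc'
  have hsepw := hsep hw hw' hne
  have hbound : ∀ v ∈ W, ∀ γ, |ε / 10 * q (rep v) γ| ≤ 1 + 2 * (ε / 10) := by
    intro v hv γ
    by_cases hγ : γ ∈ (q (rep v)).support
    · refine abs_le_of_norm_mkQ_le (X := spaceXPairing φ) (w := rep v) (hinf γ) ?_
        (fun p hp hkp => (hcode (rep v)).fst p hkp γ hγ hp)
      rw [hrep]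
      exact mem_closedBall_zero_iff.mp (hW hv)
    · rw [Finsupp.notMem_support_iff.mp hγ]
      simp
      positivity
  -- Coefficients of one type never subtract: at each index they agree or one of them is `0`. The
  -- distance is thus at most `1 + 6 * (ε / 10) < 1 + ε`.
  have := hc.norm_mkQ_sub_le hφ hε' hc' (t := 1 + 2 * (ε / 10)) (by positivity) (by
    intro γ
    by_cases h1 : γ ∈ (q (rep w)).support <;> by_cases h2 : γ ∈ (q (rep w')).support
    · rw [(hχ _).eq_of_mem_support hc.disjointFrom hc'.disjointFrom hmap h1 h2, sub_self, abs_zero]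
      positivity
    · rw [Finsupp.notMem_support_iff.mp h2, Int.cast_zero, mul_zero, sub_zero]
      exact hbound w hw γ
    · rw [Finsupp.notMem_support_iff.mp h1, Int.cast_zero, mul_zero, zero_sub, abs_neg]
      exact hbound w' hw' γ
    · rw [Finsupp.notMem_support_iff.mp h1, Finsupp.notMem_support_iff.mp h2, sub_self, abs_zero]
      positivity)
  rw [hrep, hrep] at this
  linarith

lemma one_le_norm_pairFn_sub (hφ : AlmostDisjointPairs φ) (hinf : ∀ α, (φ α).1.Infinite)
    {α β : ι} (h : α ≠ β) : 1 ≤ ‖pairFn φ α - pairFn φ β‖ := by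
  classical
  obtain ⟨k, hk⟩ := hφ.exists_disjointFrom {α, β}
  obtain ⟨p, hp, hkp⟩ := (hinf α).exists_gt k
  have h1 := hk p hkp.le α (by simp) β (by simp)
  have h2 := hk p hkp.le α (by simp) α (by simp)
  have hβ : p ∉ (φ β).1 := fun hb => h (h1.1 hp hb)
  refine le_trans ?_ (lp.norm_apply_le_norm (by simp) (pairFn φ α - pairFn φ β) p)
  rw [lp.coeFn_sub, Pi.sub_apply, pairFn_apply, pairFn_apply]
  simp [hp, hβ, h1.2.2 hp, h2.2.2 hp]

theorem not_separableSpace_spaceXPairing [Uncountable ι] (hφ : AlmostDisjointPairs φ)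
    (hinf : ∀ α, (φ α).1.Infinite) : ¬ TopologicalSpace.SeparableSpace (spaceXPairing φ) := by
  intro _
  let g : ι → spaceXPairing φ := fun α => ⟨pairFn φ α, pairFn_mem_spaceXPairing α⟩
  have hdisj : Pairwise fun α β =>
      Disjoint (Metric.ball (g α) (1 / 2)) (Metric.ball (g β) (1 / 2)) := by
    intro α β h
    refine Metric.ball_disjoint_ball ?_
    rw [dist_eq_norm]
    refine le_trans (by norm_num) (one_le_norm_pairFn_sub hφ hinf h)
  have := Set.PairwiseDisjoint.countable_of_isOpen (s := fun α => Metric.ball (g α) (1 / 2))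
    (a := Set.univ) (fun α _ β _ h => hdisj h) (fun _ _ => Metric.isOpen_ball)
    (fun α _ => ⟨g α, Metric.mem_ball_self (by norm_num)⟩)
  exact Set.not_countable_univ this

lemma spaceXPairing_le_spaceX {𝒜 : Set (Set ℕ)} (h : ∀ α, (φ α).1 ∈ 𝒜 ∧ (φ α).2 ∈ 𝒜) :
    spaceXPairing φ ≤ spaceX 𝒜 := by
  refine Submodule.topologicalClosure_mono (Submodule.span_le.mpr ?_)
  rintro _ (hf | ⟨α, rfl⟩)
  · exact Submodule.subset_span (Or.inl hf)
  · exact Submodule.sub_mem _ (Submodule.subset_span (Or.inr ⟨_, (h α).1, rfl⟩))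
      (Submodule.subset_span (Or.inr ⟨_, (h α).2, rfl⟩))

end Separation

/-! ### The theorem for the Luzin pairing -/

lemma almostDisjointPairs_luzinPair : AlmostDisjointPairs luzinPair where
  fst _ _ h := luzin_inter_finite (evenIdx_strictMono.injective.ne h)
  snd _ _ h := luzin_inter_finite (oddIdx_strictMono.injective.ne h)
  fst_snd α β := luzin_inter_finite (evenIdx_ne_oddIdx α β)

end ADSpace

theorem theorem1p4 :
    ∃ (𝒜 : Set (Set ℕ)) (φ : ADSpace.Omega1 → Set ℕ × Set ℕ)
      (X : Submodule ℝ ADSpace.Linfty) (Y : Submodule ℝ X),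
      ADSpace.IsLuzinFamily 𝒜 ∧ ADSpace.IsPairing 𝒜 φ ∧
      X = ADSpace.spaceXPairing φ ∧ X ≤ ADSpace.spaceX 𝒜 ∧
      Y.map X.subtype = ADSpace.cZero ∧
      CompleteSpace X ∧ ¬ TopologicalSpace.SeparableSpace X ∧
      IsClosed (Y : Set X) ∧ TopologicalSpace.SeparableSpace Y ∧
      (∀ δ : ℝ, 0 < δ → ∃ ε : ℝ, 0 < ε ∧ ∀ Z : Set X, Z ⊆ Metric.sphere 0 1 →
        Set.InjOn Y.mkQ Z → ADSpace.IsSeparatedBy (1 - ε) (Y.mkQ '' Z) →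
        ∃ S : ℕ → Set X, Z = ⋃ n, S n ∧ ∀ n, ADSpace.IsSeparatedBy (2 - δ) (S n)) ∧
      (∀ ε : ℝ, 0 < ε → ¬ ∃ W : Set (X ⧸ Y),
        W ⊆ Metric.closedBall 0 1 ∧ ¬ W.Countable ∧ ADSpace.IsSeparatedBy (1 + ε) W) := by
  open ADSpace in
  have hφ := almostDisjointPairs_luzinPair
  have hinf : ∀ α, (luzinPair α).1.Infinite := fun α => luzin_infinite _
  have := uncountable_omega1
  refine ⟨Set.range luzin, luzinPair, spaceXPairing luzinPair, cZeroIn _,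
    isLuzinFamily_range_luzin, isPairing_luzinPair, rfl,
    spaceXPairing_le_spaceX fun α => ⟨(isPairing_luzinPair.1 α).1, (isPairing_luzinPair.1 α).2.1⟩,
    ?_, ?_, not_separableSpace_spaceXPairing hφ hinf, ?_, ?_, ?_, ?_⟩
  · rw [cZeroIn, Submodule.map_comap_subtype]
    exact inf_eq_right.mpr cZero_le_spaceXPairing
  · exact (Submodule.isClosed_topologicalClosure _).completeSpace_coe
  · exact isClosed_cZero.preimage continuous_subtype_val
  · have hsep : TopologicalSpace.IsSeparable
        (cZeroIn (spaceXPairing luzinPair) : Set (spaceXPairing luzinPair)) :=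
      Topology.IsInducing.subtypeVal.isSeparable_preimage isSeparable_cZero
    exact hsep.separableSpace
  · intro δ hδ
    obtain ⟨ε, hε, h⟩ := exists_countable_separated_cover hφ exists_luzinPair_coloring hδ
    exact ⟨ε, hε, fun Z _ => h Z⟩
  · rintro ε hε ⟨W, hW, hunc, hsep⟩
    exact hunc (countable_of_separated_quotient hφ hinf exists_luzinPair_coloring hε hW hsep)
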